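/- **Setting.** Let $\mathscr F$ be a $\sigma$-algebra of subsets of a set $X$. A *charge* is a finitely additive function $\mu:\mathscr F\to[0,\infty)$ with $\mu(\emptyset)=0$ (so all charges are nonnegative and bounded). A charge $\mu$ has the *additive property* if for every $\varepsilon>0$ and every increasing sequence $A_1\subseteq A_2\subseteq\cdots$ in $\mathscr F$ there is $B\in\mathscr F$ with $\mu(B)\le\lim_{i\to\infty}\mu(A_i)+\varepsilon$ and $\mu(A_i\setminus B)=0$ for all $i$. Charges $\mu,\nu$ are *singular* if for every $\varepsilon>0$ there is $D\in\mathscr F$ with $\mu(D)<\varepsilon$ and $\nu(D^c)<\varepsilon$; they are *strongly singular* if there is $D\in\mathscr F$ with $\mu(D)=0$ and $\nu(D^c)=0$. Let $F$ be the Stone space of the Boolean algebra $\mathscr F$, and let $\phi$ be the canonical isomorphism from $\mathscr F$ onto the algebra of clopen subsets of $F$. For a charge $\mu$ let $\hat\mu$ be the unique regular Borel measure on $F$ with $\hat\mu(\phi(A))=\mu(A)$ for all $A\in\mathscr F$, and let $\operatorname{supp}\mu\subseteq F$ be the topological support of $\hat\mu$. **Theorem 4.3.** Let $(\mu_i)_{i\ge1}$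 be a sequence of charges on $\mathscr F$ such that $\mu_i$ and $\mu_j$ are singular whenever $i\ne j$, and suppose that $\mu=\sum_{i\ge1}\mu_i$ exists, i.e. $\mu$ is a charge and $\mu(A)=\sum_{i\ge1}\mu_i(A)$ for every $A\in\mathscr F$. Put $S_i=\operatorname{supp}\mu_i$. Then $\mu$ has the additive property if and only if the following three conditions all hold: 1. each $\mu_i$ has the additive property; 2. $\mu_i$ and $\mu_j$ are strongly singular whenever $i\neq j$; 3. $\left(\limsup_i S_i\right)\cap\bigcup_{i\ge1}S_i=\emptyset$, where $\limsup_i S_i=\bigcap_{i\ge1}\overline{\bigcup_{j\ge i}S_j}$. -/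

import Mathlib

open MeasureTheory Set Filter Topology
open scoped NNReal ENNReal

namespace ChargeTheory

/-! ### Charges on a σ-algebra -/

/-- A charge on the σ-algebra of `X`: a finitely additive set function defined on the measurable
sets, nonnegative and bounded (it takes values in `ℝ≥0`, and `μ A ≤ μ univ`). The values on sets
which are not measurable are meaningless and are never used. -/
abbrev Charge (X : Type*) [MeasurableSpace X] : Type _ :=
  AddContent ℝ≥0 {s : Set X | MeasurableSet s}

/-- The additive property: for every `ε > 0` and every increasing sequence `A` of measurable sets
there is a measurable `B` with `μ B ≤ lim μ (A i) + ε` and `μ (A i \ B) = 0` for all `i`.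
The limit `L` always exists, the sequence `μ (A i)` being increasing and bounded. -/
def AdditiveProperty {X : Type*} [MeasurableSpace X] (μ : Charge X) : Prop :=
  ∀ ε : ℝ≥0, 0 < ε → ∀ A : ℕ → Set X, (∀ i, MeasurableSet (A i)) → Monotone A →
    ∀ L : ℝ≥0, Tendsto (fun i => μ (A i)) atTop (𝓝 L) →
      ∃ B : Set X, MeasurableSet B ∧ μ B ≤ L + ε ∧ ∀ i, μ (A i \ B) = 0

/-- Singularity of charges. -/
def Singular {X : Type*} [MeasurableSpace X] (μ ν : Charge X) : Prop :=
  ∀ ε : ℝ≥0, 0 < ε → ∃ D : Set X, MeasurableSet D ∧ μ D < ε ∧ ν Dᶜ < ε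

/-- Strong singularity of charges. -/
def StronglySingular {X : Type*} [MeasurableSpace X] (μ ν : Charge X) : Prop :=
  ∃ D : Set X, MeasurableSet D ∧ μ D = 0 ∧ ν Dᶜ = 0

/-! ### The Stone space of a Boolean algebra -/

/-- The Stone space of a Boolean algebra `B`: the homomorphisms from `B` to the two-element
Boolean algebra (equivalently, the ultrafilters of `B`). -/
def StoneSpace (B : Type*) [BooleanAlgebra B] : Type _ := BoundedLatticeHom B Bool

namespace StoneSpace

variable {B : Type*} [BooleanAlgebra B]

instance : FunLike (StoneSpace B) B Bool :=
  inferInstanceAs (FunLike (BoundedLatticeHom B Bool) B Bool)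

instance : BoundedLatticeHomClass (StoneSpace B) B Bool :=
  inferInstanceAs (BoundedLatticeHomClass (BoundedLatticeHom B Bool) B Bool)

/-- The topology of pointwise convergence, `Bool` being discrete. -/
instance : TopologicalSpace (StoneSpace B) :=
  TopologicalSpace.induced (fun (x : StoneSpace B) (a : B) => x a) inferInstance

/-- The Borel σ-algebra. -/
instance : MeasurableSpace (StoneSpace B) := borel _

instance : BorelSpace (StoneSpace B) := ⟨rfl⟩

/-- The set of points of the Stone space that corresponds to an element of the algebra. -/
def basic (a : B) : Set (StoneSpace B) := {x | x a = true}

theorem isClosedEmbedding_coe :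
    IsClosedEmbedding (fun (x : StoneSpace B) (a : B) => x a) := by
  refine ⟨⟨⟨rfl⟩, fun x y h => DFunLike.coe_injective h⟩, ?_⟩
  have h : range (fun (x : StoneSpace B) (a : B) => x a) =
      {f | f ⊤ = ⊤} ∩ {f | f ⊥ = ⊥} ∩ (⋂ (a : B) (b : B), {f | f (a ⊔ b) = f a ⊔ f b}) ∩
        (⋂ (a : B) (b : B), {f | f (a ⊓ b) = f a ⊓ f b}) := by
    ext f
    simp only [mem_range, mem_inter_iff, mem_ofPred_eq, mem_iInter]
    constructor
    · rintro ⟨x, rfl⟩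
      exact ⟨⟨⟨map_top x, map_bot x⟩, map_sup x⟩, map_inf x⟩
    · rintro ⟨⟨⟨h1, h2⟩, h3⟩, h4⟩
      exact ⟨({ toFun := f, map_sup' := h3, map_inf' := h4, map_top' := h1, map_bot' := h2 } :
        BoundedLatticeHom B Bool), rfl⟩
  rw [h]
  have hs (g : Bool × Bool → Bool) (a b c : B) :
      IsClosed {f : B → Bool | f a = g (f b, f c)} :=
    isClosed_eq (continuous_apply a)
      (continuous_of_discreteTopology.comp ((continuous_apply b).prodMk (continuous_apply c)))
  refine IsClosed.inter (IsClosed.inter (IsClosed.inter ?_ ?_) ?_) ?_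
  · exact isClosed_eq (continuous_apply _) continuous_const
  · exact isClosed_eq (continuous_apply _) continuous_const
  · exact isClosed_iInter fun a => isClosed_iInter fun b => hs (fun p => p.1 ⊔ p.2) _ a b
  · exact isClosed_iInter fun a => isClosed_iInter fun b => hs (fun p => p.1 ⊓ p.2) _ a b

instance : CompactSpace (StoneSpace B) := isClosedEmbedding_coe.compactSpace

instance : T2Space (StoneSpace B) := isClosedEmbedding_coe.isEmbedding.t2Space

instance : TotallyDisconnectedSpace (StoneSpace B) :=
  isClosedEmbedding_coe.isEmbedding.isTotallyDisconnected_range.mp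
    (isTotallyDisconnected_of_totallyDisconnectedSpace _)

theorem basic_top : basic (⊤ : B) = univ := by
  ext x; simp [basic]

theorem basic_sup (a b : B) : basic (a ⊔ b) = basic a ∪ basic b := by
  ext x; simp [basic]

theorem basic_inf (a b : B) : basic (a ⊓ b) = basic a ∩ basic b := by
  ext x; simp [basic]

theorem basic_bot : basic (⊥ : B) = ∅ := by
  ext x; simp [basic]

theorem basic_compl (a : B) : basic aᶜ = (basic a)ᶜ := by
  refine (IsCompl.of_eq ?_ ?_).compl_eq.symm
  · exact (basic_inf a aᶜ).symm.trans (by rw [inf_compl_self, basic_bot]; rfl)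
  · exact (basic_sup a aᶜ).symm.trans (by rw [sup_compl_eq_top, basic_top]; rfl)

theorem isClopen_basic (a : B) : IsClopen (basic a) :=
  (isClopen_discrete {true}).preimage
    ((continuous_apply a).comp isClosedEmbedding_coe.continuous)

/-- The sets `basic a` separate compact sets from the complements of their neighbourhoods. -/
theorem exists_basic_between {K U : Set (StoneSpace B)} (hK : IsCompact K) (hU : IsOpen U)
    (h : K ⊆ U) : ∃ a : B, K ⊆ basic a ∧ basic a ⊆ U := by
  have hpt : ∀ x ∈ U, ∃ a : B, x ∈ basic a ∧ basic a ⊆ U := by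
    intro x hx
    obtain ⟨V, hV, rfl⟩ := isClosedEmbedding_coe.isInducing.isOpen_iff.mp hU
    obtain ⟨I, u, hu, hsub⟩ := isOpen_pi_iff.mp hV _ hx
    refine ⟨I.inf fun b => if x b = true then b else bᶜ, ?_, ?_⟩
    · change x _ = true
      have h1 : x (I.inf fun b => if x b = true then b else bᶜ) = ⊤ := by
        rw [map_finset_inf]
        refine (Finset.inf_eq_top_iff _ _).mpr fun b _ => ?_
        by_cases hb : x b = true
        · simp [hb]
        · simp [hb]
      exact h1
    · intro y hy
      refine hsub fun b hb => ?_
      have h2 : y (if x b = true then b else bᶜ) = true := by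
        have := OrderHomClass.mono y
          (Finset.inf_le (f := fun b => if x b = true then b else bᶜ) hb)
        rw [show y _ = true from hy] at this
        exact top_le_iff.mp this
      have h3 : y b = x b := by
        by_cases hxb : x b = true
        · rw [if_pos hxb] at h2; rw [h2, hxb]
        · rw [if_neg hxb] at h2
          have h4 : y ∈ basic bᶜ := h2
          rw [basic_compl] at h4
          have h5 : ¬ y b = true := h4
          rw [Bool.not_eq_true] at hxb h5
          rw [h5, hxb]
      change y b ∈ u b
      rw [h3]
      exact (hu b hb).2
  refine hK.induction_on (p := fun K => ∃ a : B, K ⊆ basic a ∧ basic a ⊆ U) ?_ ?_ ?_ ?_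
  · exact ⟨⊥, empty_subset _, by simp [basic_bot]⟩
  · rintro s t hst ⟨a, h1, h2⟩
    exact ⟨a, hst.trans h1, h2⟩
  · rintro s t ⟨a, h1, h2⟩ ⟨b, h3, h4⟩
    exact ⟨a ⊔ b, by rw [basic_sup]; exact union_subset_union h1 h3,
      by rw [basic_sup]; exact union_subset h2 h4⟩
  · intro x hx
    obtain ⟨a, h1, h2⟩ := hpt x (h hx)
    exact ⟨basic a, mem_nhdsWithin_of_mem_nhds ((isClopen_basic a).isOpen.mem_nhds h1), a,
      subset_rfl, h2⟩

/-- The clopen sets are exactly the sets `basic a`. -/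
theorem isClopen_iff {C : Set (StoneSpace B)} : IsClopen C ↔ ∃ a : B, C = basic a := by
  constructor
  · intro h
    obtain ⟨a, h1, h2⟩ := exists_basic_between h.isClosed.isCompact h.isOpen subset_rfl
    exact ⟨a, h1.antisymm h2⟩
  · rintro ⟨a, rfl⟩
    exact isClopen_basic a

/-- `a ↦ basic a` is injective. -/
theorem basic_subset_basic_iff {a b : B} : basic a ⊆ basic b ↔ a ≤ b := by
  constructor
  · intro h
    by_contra hab
    have hd : Disjoint (Order.PFilter.principal a : Set B) (Order.Ideal.principal b : Set B) := by
      refine Set.disjoint_left.mpr fun c hc hc' => hab ?_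
      exact le_trans (Order.PFilter.mem_principal.mp hc) (Order.Ideal.mem_principal.mp hc')
    obtain ⟨J, hJ, hbJ, hdJ⟩ := DistribLattice.prime_ideal_of_disjoint_filter_ideal hd
    have hsup (c d : B) : c ⊔ d ∈ J ↔ c ∈ J ∧ d ∈ J := Order.Ideal.sup_mem_iff
    have hinf (c d : B) : c ⊓ d ∈ J ↔ c ∈ J ∨ d ∈ J :=
      ⟨hJ.mem_or_mem, fun h' => h'.elim (J.lower inf_le_left) (J.lower inf_le_right)⟩
    have htop : (⊤ : B) ∉ J := hJ.toIsProper.top_notMem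
    classical
    let x : StoneSpace B := ({ toFun := fun c => decide (c ∉ J)
                               map_sup' := fun c d => by
                                by_cases hc : c ∈ J <;> by_cases hd : d ∈ J <;>
                                  simp [hsup, hc, hd]
                               map_inf' := fun c d => by
                                by_cases hc : c ∈ J <;> by_cases hd : d ∈ J <;>
                                  simp [hinf, hc, hd]
                               map_top' := by simp [htop]
                               map_bot' := by simp } : BoundedLatticeHom B Bool)
    have hxa : x ∈ basic a := by
      change decide (a ∉ J) = true
      exact decide_eq_true (Set.disjoint_left.mp hdJ (Order.PFilter.mem_principal.mpr le_rfl))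
    have hxb : decide (b ∉ J) = true := h hxa
    exact of_decide_eq_true hxb (hbJ (Order.Ideal.mem_principal.mpr le_rfl))
  · intro h
    rw [← sup_eq_right.mpr h, basic_sup]
    exact subset_union_left

end StoneSpace

/-! ### The extended measure on the Stone space -/

section Extension

variable {X : Type*} [MeasurableSpace X]

/-- The Stone space of the σ-algebra of `X`. -/
abbrev StoneOf (X : Type*) [MeasurableSpace X] : Type _ :=
  StoneSpace {s : Set X // MeasurableSet s}

theorem isSetRing_measurableSet : IsSetRing {s : Set X | MeasurableSet s} :=
  ⟨MeasurableSet.empty, fun _ _ hs ht => hs.union ht, fun _ _ hs ht => hs.diff ht⟩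

/-- The value of the charge `μ` on a compact set `K` of the Stone space: the infimum of `μ A`
over all measurable `A` whose clopen set contains `K`. -/
noncomputable def compactValue (μ : Charge X) (K : Set (StoneOf X)) : ℝ≥0 :=
  sInf {r | ∃ A : {s : Set X // MeasurableSet s}, K ⊆ StoneSpace.basic A ∧ r = μ (A : Set X)}

theorem compactValue_le (μ : Charge X) {K : Set (StoneOf X)}
    {A : {s : Set X // MeasurableSet s}} (h : K ⊆ StoneSpace.basic A) :
    compactValue μ K ≤ μ (A : Set X) :=
  csInf_le (OrderBot.bddBelow _) ⟨A, h, rfl⟩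

theorem le_compactValue (μ : Charge X) {K : Set (StoneOf X)} {r : ℝ≥0}
    (h : ∀ A : {s : Set X // MeasurableSet s}, K ⊆ StoneSpace.basic A → r ≤ μ (A : Set X)) :
    r ≤ compactValue μ K := by
  refine le_csInf ⟨_, ⊤, by rw [StoneSpace.basic_top]; exact subset_univ _, rfl⟩ ?_
  rintro _ ⟨A, hA, rfl⟩
  exact h A hA

theorem exists_lt_of_compactValue_lt (μ : Charge X) {K : Set (StoneOf X)} {r : ℝ≥0}
    (h : compactValue μ K < r) :
    ∃ A : {s : Set X // MeasurableSet s}, K ⊆ StoneSpace.basic A ∧ μ (A : Set X) < r := by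
  by_contra! hc
  exact absurd (le_compactValue μ hc) (not_le.mpr h)

/-- The content on the compact subsets of the Stone space induced by a charge. -/
noncomputable def content (μ : Charge X) : Content (StoneOf X) where
  toFun K := compactValue μ K
  mono' K₁ K₂ h := le_compactValue μ fun _ hA => compactValue_le μ (h.trans hA)
  sup_le' K₁ K₂ := by
    refine le_of_forall_pos_le_add fun ε hε => ?_
    obtain ⟨A, hA, hA'⟩ := exists_lt_of_compactValue_lt μ
      (lt_add_of_pos_right (compactValue μ (K₁ : Set (StoneOf X))) (half_pos hε))
    obtain ⟨C, hC, hC'⟩ := exists_lt_of_compactValue_lt μ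
      (lt_add_of_pos_right (compactValue μ (K₂ : Set (StoneOf X))) (half_pos hε))
    calc compactValue μ ((K₁ ⊔ K₂ : TopologicalSpace.Compacts (StoneOf X)) : Set (StoneOf X))
        ≤ μ ((A ⊔ C : {s : Set X // MeasurableSet s}) : Set X) := by
          refine compactValue_le μ ?_
          rw [StoneSpace.basic_sup, TopologicalSpace.Compacts.coe_sup]
          exact union_subset_union hA hC
      _ ≤ μ (A : Set X) + μ (C : Set X) :=
          addContent_union_le isSetRing_measurableSet A.2 C.2
      _ ≤ (compactValue μ K₁ + ε / 2) + (compactValue μ K₂ + ε / 2) :=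
          add_le_add hA'.le hC'.le
      _ = compactValue μ K₁ + compactValue μ K₂ + ε := by
          rw [add_add_add_comm, add_halves]
  sup_disjoint' K₁ K₂ hd h₁ h₂ := by
    obtain ⟨C, hC₁, hC₂⟩ := StoneSpace.exists_basic_between K₁.isCompact h₂.isOpen_compl
      (Set.disjoint_left.mp hd)
    rw [TopologicalSpace.Compacts.coe_sup]
    refine le_antisymm ?_ (le_compactValue μ fun A hA => ?_)
    · refine le_of_forall_pos_le_add fun ε hε => ?_
      obtain ⟨A, hA, hA'⟩ := exists_lt_of_compactValue_lt μ
        (lt_add_of_pos_right (compactValue μ (K₁ : Set (StoneOf X))) (half_pos hε))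
      obtain ⟨D, hD, hD'⟩ := exists_lt_of_compactValue_lt μ
        (lt_add_of_pos_right (compactValue μ (K₂ : Set (StoneOf X))) (half_pos hε))
      calc _ ≤ μ ((A ⊔ D : {s : Set X // MeasurableSet s}) : Set X) := by
            refine compactValue_le μ ?_
            rw [StoneSpace.basic_sup]
            exact union_subset_union hA hD
        _ ≤ μ (A : Set X) + μ (D : Set X) :=
            addContent_union_le isSetRing_measurableSet A.2 D.2
        _ ≤ (compactValue μ K₁ + ε / 2) + (compactValue μ K₂ + ε / 2) :=
            add_le_add hA'.le hD'.le
        _ = compactValue μ K₁ + compactValue μ K₂ + ε := by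
            rw [add_add_add_comm, add_halves]
    · have h1 : compactValue μ K₁ ≤ μ ((A ⊓ C : {s : Set X // MeasurableSet s}) : Set X) := by
        refine compactValue_le μ ?_
        rw [StoneSpace.basic_inf]
        exact subset_inter (subset_union_left.trans hA) hC₁
      have h2 : compactValue μ K₂ ≤ μ ((A ⊓ Cᶜ : {s : Set X // MeasurableSet s}) : Set X) := by
        refine compactValue_le μ ?_
        rw [StoneSpace.basic_inf, StoneSpace.basic_compl]
        exact subset_inter (subset_union_right.trans hA) (subset_compl_comm.mp hC₂)
      refine (add_le_add h1 h2).trans_eq ?_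
      have h3 : ((A : Set X) ∩ C) ∪ ((A : Set X) ∩ (C : Set X)ᶜ) = A := inter_union_compl _ _
      have h4 := addContent_union (m := μ) isSetRing_measurableSet (s := (A : Set X) ∩ C)
        (t := (A : Set X) ∩ (C : Set X)ᶜ) (A.2.inter C.2) (A.2.inter C.2.compl)
        (disjoint_compl_right.mono inter_subset_right inter_subset_right)
      rw [h3] at h4
      exact h4.symm

/-- The regular Borel measure on the Stone space which extends the charge `μ`. -/
noncomputable def extendedMeasure (μ : Charge X) : Measure (StoneOf X) := (content μ).measure

instance (μ : Charge X) : (extendedMeasure μ).Regular :=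
  inferInstanceAs (content μ).measure.Regular

/-- The extended measure agrees with the charge on the clopen sets. -/
theorem extendedMeasure_basic (μ : Charge X) (A : {s : Set X // MeasurableSet s}) :
    extendedMeasure μ (StoneSpace.basic A) = μ (A : Set X) := by
  have hc := StoneSpace.isClopen_basic A
  rw [extendedMeasure, Content.measure_apply _ hc.isOpen.measurableSet,
    Content.outerMeasure_of_isOpen _ _ hc.isOpen,
    Content.innerContent_of_isCompact _ hc.isClosed.isCompact]
  refine congrArg _ (le_antisymm (compactValue_le μ subset_rfl) (le_compactValue μ fun C hC => ?_))
  have hAC : A ≤ C := StoneSpace.basic_subset_basic_iff.mp hC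
  exact addContent_mono isSetRing_measurableSet.isSetSemiring A.2 C.2 hAC

/-- The extended measure is the only regular Borel measure which agrees with the charge on the
clopen sets. -/
theorem eq_extendedMeasure (μ : Charge X) (m : Measure (StoneOf X)) [m.Regular]
    (h : ∀ A : {s : Set X // MeasurableSet s}, m (StoneSpace.basic A) = μ (A : Set X)) :
    m = extendedMeasure μ := by
  have key (ν₁ ν₂ : Measure (StoneOf X)) [ν₁.Regular] [ν₂.Regular]
      (h12 : ∀ A : {s : Set X // MeasurableSet s},
        ν₁ (StoneSpace.basic A) = ν₂ (StoneSpace.basic A))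
      {U : Set (StoneOf X)} (hU : IsOpen U) : ν₁ U ≤ ν₂ U := by
    rw [hU.measure_eq_iSup_isCompact]
    refine iSup₂_le fun K hK => iSup_le fun hKc => ?_
    obtain ⟨A, h1, h2⟩ := StoneSpace.exists_basic_between hKc hU hK
    exact (measure_mono h1).trans ((h12 A).le.trans (measure_mono h2))
  have hA (A : {s : Set X // MeasurableSet s}) :
      m (StoneSpace.basic A) = extendedMeasure μ (StoneSpace.basic A) := by
    rw [h, extendedMeasure_basic]
  exact Measure.OuterRegular.ext_isOpen fun U hU =>
    le_antisymm (key _ _ hA hU) (key _ _ (fun A => (hA A).symm) hU)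

/-- The support of a charge: the topological support of the extended measure. -/
noncomputable def supp (μ : Charge X) : Set (StoneOf X) := (extendedMeasure μ).support

end Extension

end ChargeTheory

/-! Everything passes through `StronglySeparated`: each `μs i` lives on a measurable set that is
null for all the other terms at once. Conditions 2 and 3 together are equivalent to it. If `μ` has
the additive property, so does every charge below it, and singularity of two charges below `μ`
improves to strong singularity (`AdditiveProperty.stronglySingular`). Applied to `μs i` and `μ - μs
i`, which are singular because finitely many terms carry almost all the mass, this gives separation.
Disjointness of `supp (μs i)` from the limsup becomes, by compactness of the Stone space, a clopen
set that contains `supp (μs i)` and misses all late supports; strong singularity handles the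
finitely many remaining indices. Conversely, separating sets can be made disjoint, and the
approximating sets of the individual charges, cut down to them, glue to one for `μ`. -/

namespace ChargeTheory

/-! ### Finite additivity, and charges below a charge with the additive property. -/

section Basic

variable {X : Type*} [MeasurableSpace X]

theorem charge_mono (μ : Charge X) {A B : Set X} (hA : MeasurableSet A) (hB : MeasurableSet B)
    (h : A ⊆ B) : μ A ≤ μ B :=
  addContent_mono isSetRing_measurableSet.isSetSemiring hA hB h

theorem charge_eq_zero_of_subset (μ : Charge X) {A B : Set X} (hA : MeasurableSet A)
    (hB : MeasurableSet B) (h : A ⊆ B) (h0 : μ B = 0) : μ A = 0 :=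
  le_antisymm ((charge_mono μ hA hB h).trans h0.le) zero_le

theorem charge_inter_add_diff (μ : Charge X) {A B : Set X} (hA : MeasurableSet A)
    (hB : MeasurableSet B) : μ (A ∩ B) + μ (A \ B) = μ A := by
  rw [← addContent_union isSetRing_measurableSet (hA.inter hB) (hA.diff hB)
    (disjoint_sdiff_right.mono_left inter_subset_right), inter_union_sdiff]

theorem charge_add_compl (μ : Charge X) {A : Set X} (hA : MeasurableSet A) :
    μ A + μ Aᶜ = μ univ := by
  rw [← addContent_union isSetRing_measurableSet hA hA.compl disjoint_compl_right,
    union_compl_self]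

theorem charge_le_add (μ : Charge X) {A B C : Set X} (hA : MeasurableSet A)
    (hB : MeasurableSet B) (hC : MeasurableSet C) (h : A ⊆ B ∪ C) : μ A ≤ μ B + μ C :=
  (charge_mono μ hA (hB.union hC) h).trans (addContent_union_le isSetRing_measurableSet hB hC)

theorem exists_tendsto_charge (μ : Charge X) {A : ℕ → Set X} (hA : ∀ i, MeasurableSet (A i))
    (hm : Monotone A) : ∃ L : ℝ≥0, Tendsto (fun i => μ (A i)) atTop (𝓝 L) :=
  ⟨_, tendsto_atTop_ciSup (fun i j hij => charge_mono μ (hA i) (hA j) (hm hij))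
    ⟨μ univ, by
      rintro _ ⟨i, rfl⟩
      exact charge_mono μ (hA i) MeasurableSet.univ (subset_univ _)⟩⟩

/-- The difference of a charge and a smaller charge. -/
noncomputable def chargeSub (μ α : Charge X) (h : ∀ A, MeasurableSet A → α A ≤ μ A) : Charge X :=
  IsSetRing.addContent_of_union (fun A => μ A - α A) isSetRing_measurableSet (by simp)
    fun {s t} hs ht hd => by
      rw [addContent_union isSetRing_measurableSet hs ht hd,
        addContent_union isSetRing_measurableSet hs ht hd, tsub_add_tsub_comm (h s hs) (h t ht)]

theorem chargeSub_apply (μ α : Charge X) (h : ∀ A, MeasurableSet A → α A ≤ μ A) (A : Set X) :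
    chargeSub μ α h A = μ A - α A := rfl

theorem Singular.symm {μ ν : Charge X} (h : Singular μ ν) : Singular ν μ := fun ε hε => by
  obtain ⟨D, hD, h1, h2⟩ := h ε hε
  exact ⟨Dᶜ, hD.compl, h2, by rwa [compl_compl]⟩

/-- The additive property of `μ` gives approximations for every charge below `μ`. -/
theorem AdditiveProperty.exists_approx {μ α : Charge X} (hμ : AdditiveProperty μ)
    (hle : ∀ A, MeasurableSet A → α A ≤ μ A) {ε : ℝ≥0} (hε : 0 < ε) {A : ℕ → Set X}
    (hA : ∀ i, MeasurableSet (A i)) (hm : Monotone A) {L : ℝ≥0}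
    (hL : Tendsto (fun i => α (A i)) atTop (𝓝 L)) :
    ∃ B : Set X, MeasurableSet B ∧ α B ≤ L + ε ∧ ∀ i, μ (A i \ B) = 0 := by
  obtain ⟨M, hM⟩ := exists_tendsto_charge μ hA hm
  obtain ⟨B, hB, hBM, hB0⟩ := hμ ε hε A hA hm M hM
  refine ⟨B, hB, ?_, hB0⟩
  -- Since `μ (A n \ B) = 0`, the excess `μ (B \ A n)` is `μ B - μ (A n)`, and it dominates `α (B \
  -- A n)`. In the limit `M` cancels.
  have key : ∀ n, α B + μ (A n) ≤ α (A n) + (M + ε) := fun n => by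
    have h1 : α B ≤ α (A n) + μ (B \ A n) := by
      rw [← charge_inter_add_diff α hB (hA n)]
      exact add_le_add (charge_mono α (hB.inter (hA n)) (hA n) inter_subset_right)
        (hle _ (hB.diff (hA n)))
    have h2 := charge_inter_add_diff μ hB (hA n)
    have h3 := charge_inter_add_diff μ (hA n) hB
    rw [hB0, add_zero, inter_comm] at h3
    rw [h3] at h2
    calc α B + μ (A n) ≤ α (A n) + μ (B \ A n) + μ (A n) := by gcongr
      _ = α (A n) + μ B := by rw [← h2, add_assoc, add_comm (μ (B \ A n))]
      _ ≤ α (A n) + (M + ε) := by gcongr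
  have h := le_of_tendsto_of_tendsto' (hM.const_add (α B)) (hL.add_const (M + ε)) key
  rw [add_comm M ε, ← add_assoc] at h
  exact le_of_add_le_add_right h

theorem AdditiveProperty.of_le {μ α : Charge X} (hμ : AdditiveProperty μ)
    (hle : ∀ A, MeasurableSet A → α A ≤ μ A) : AdditiveProperty α := by
  intro ε hε A hA hm L hL
  obtain ⟨B, hB, h1, h2⟩ := hμ.exists_approx hle hε hA hm hL
  exact ⟨B, hB, h1, fun i => le_antisymm ((hle _ ((hA i).diff hB)).trans (h2 i).le) zero_le⟩

/-- Below a charge with the additive property, of two singular charges the second is concentrated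
on sets which are arbitrarily small for the first. -/
theorem AdditiveProperty.exists_small_conull {μ α β : Charge X} (hμ : AdditiveProperty μ)
    (hα : ∀ A, MeasurableSet A → α A ≤ μ A) (hβ : ∀ A, MeasurableSet A → β A ≤ μ A)
    (h : Singular α β) {ε : ℝ≥0} (hε : 0 < ε) :
    ∃ B : Set X, MeasurableSet B ∧ α B ≤ ε ∧ β Bᶜ = 0 := by
  obtain ⟨δ, hδ, c, hc, hcε⟩ := NNReal.exists_pos_sum_of_countable (half_pos hε).ne' ℕ
  choose D hD hαD hβD using fun n => h (δ n) (hδ n)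
  -- The partial unions have `α`-value at most `∑ δ k < ε / 2`, so a set covering them up to
  -- `μ`-null sets stays small for `α`; up to a `β`-null set it contains each `D n`, whose
  -- complement has `β`-value below `δ n`.
  have hA : ∀ n, MeasurableSet (⋃ k ∈ Finset.range (n + 1), D k) := fun n =>
    Finset.measurableSet_biUnion _ fun k _ => hD k
  have hm : Monotone fun n => ⋃ k ∈ Finset.range (n + 1), D k := fun m n hmn =>
    biUnion_subset_biUnion_left fun k hk => Finset.range_mono (by omega) hk
  obtain ⟨L, hL⟩ := exists_tendsto_charge α hA hm
  have hLε : L ≤ ε / 2 := le_of_tendsto' hL fun n => by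
    refine (addContent_biUnion_le isSetRing_measurableSet fun k _ => hD k).trans ?_
    refine (Finset.sum_le_sum fun k _ => (hαD k).le).trans ?_
    exact (sum_le_hasSum _ (fun _ _ => zero_le) hc).trans hcε.le
  obtain ⟨B, hB, h1, h2⟩ := hμ.exists_approx hα (half_pos hε) hA hm hL
  refine ⟨B, hB, ?_, ?_⟩
  · calc α B ≤ L + ε / 2 := h1
      _ ≤ ε / 2 + ε / 2 := by gcongr
      _ = ε := add_halves ε
  · have hlim : Tendsto δ atTop (𝓝 0) := NNReal.tendsto_atTop_zero_of_summable hc.summable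
    refine le_antisymm (ge_of_tendsto' hlim fun n => ?_) zero_le
    have h3 : β (D n \ B) = 0 := by
      refine charge_eq_zero_of_subset β ((hD n).diff hB) ((hA n).diff hB) ?_
        (le_antisymm ((hβ _ ((hA n).diff hB)).trans (h2 n).le) zero_le)
      exact sdiff_subset_sdiff_left (subset_biUnion_of_mem (u := D) (by simp))
    calc β Bᶜ ≤ β (D n)ᶜ + β (D n \ B) :=
          charge_le_add β hB.compl (hD n).compl ((hD n).diff hB) fun x hx => by
            by_cases hxD : x ∈ D n
            · exact Or.inr ⟨hxD, hx⟩
            · exact Or.inl hxD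
      _ ≤ δ n := by rw [h3, add_zero]; exact (hβD n).le

/-- Singular charges below a charge with the additive property are strongly singular. -/
theorem AdditiveProperty.stronglySingular {μ α β : Charge X} (hμ : AdditiveProperty μ)
    (hα : ∀ A, MeasurableSet A → α A ≤ μ A) (hβ : ∀ A, MeasurableSet A → β A ≤ μ A)
    (h : Singular α β) : StronglySingular α β := by
  obtain ⟨δ, -, hδ, hlim⟩ := exists_seq_strictAnti_tendsto (0 : ℝ≥0)
  choose V hV hαV hβV using fun n : ℕ => hμ.exists_small_conull hα hβ h (hδ n)
  choose W hW hβW hαW using fun n : ℕ => hμ.exists_small_conull hβ hα h.symm (hδ n)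
  have hV' : ∀ n, MeasurableSet (⋃ k ∈ Finset.range (n + 1), (V k)ᶜ) := fun n =>
    Finset.measurableSet_biUnion _ fun k _ => (hV k).compl
  have hW' : ∀ n, MeasurableSet (⋃ k ∈ Finset.range (n + 1), (W k)ᶜ) := fun n =>
    Finset.measurableSet_biUnion _ fun k _ => (hW k).compl
  have null : ∀ (γ : Charge X) (E : ℕ → Set X), (∀ n, MeasurableSet (E n)) →
      (∀ n, γ (E n)ᶜ = 0) → ∀ n, γ (⋃ k ∈ Finset.range (n + 1), (E k)ᶜ) = 0 := fun γ E hE h0 n =>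
    le_antisymm ((addContent_biUnion_le isSetRing_measurableSet fun k _ => (hE k).compl).trans
      (by simp [h0])) zero_le
  -- The sets `(V k)ᶜ` are `β`-null and the `(W k)ᶜ` are `α`-null, but only finite unions of them
  -- need remain null. In this interleaved union the pieces with index above `n` lie in `V n` and
  -- the others in finitely many `(W k)ᶜ`; dually, `Dᶜ` is covered by `W n` and finitely many `(V
  -- k)ᶜ`.
  set D : Set X := ⋃ n, (W n)ᶜ \ ⋃ k ∈ Finset.range (n + 1), (V k)ᶜ
  have hD : MeasurableSet D := MeasurableSet.iUnion fun n => (hW n).compl.diff (hV' n)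
  have hDc : ∀ n, Dᶜ ⊆ W n ∪ ⋃ k ∈ Finset.range (n + 1), (V k)ᶜ := fun n x hx => by
    by_contra hc
    rw [mem_union, not_or] at hc
    exact hx (mem_iUnion.mpr ⟨n, hc.1, hc.2⟩)
  have hDV : ∀ n, D ⊆ V n ∪ ⋃ k ∈ Finset.range (n + 1), (W k)ᶜ := fun n x hx => by
    obtain ⟨m, hxW, hxV⟩ := mem_iUnion.mp hx
    by_cases hmn : m ≤ n
    · exact Or.inr (mem_biUnion (Finset.mem_coe.mpr (Finset.mem_range.mpr (by omega))) hxW)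
    · refine Or.inl (by_contra fun hxn => hxV ?_)
      exact mem_biUnion (Finset.mem_coe.mpr (Finset.mem_range.mpr (by omega))) hxn
  refine ⟨D, hD, ?_, ?_⟩
  · refine le_antisymm (ge_of_tendsto' hlim fun n => ?_) zero_le
    have := charge_le_add α hD (hV n) (hW' n) (hDV n)
    rw [null α W hW hαW n, add_zero] at this
    exact this.trans (hαV n)
  · refine le_antisymm (ge_of_tendsto' hlim fun n => ?_) zero_le
    have := charge_le_add β hD.compl (hW n) (hV' n) (hDc n)
    rw [null β V hV hβV n, add_zero] at this
    exact this.trans (hβW n)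

end Basic

/-! ### Supports and null sets. -/

section Support

variable {X : Type*} [MeasurableSpace X]

/-- A clopen set misses the support of a charge iff the corresponding set is null. -/
theorem disjoint_supp_basic_iff (μ : Charge X) (A : {s : Set X // MeasurableSet s}) :
    Disjoint (supp μ) (StoneSpace.basic A) ↔ μ (A : Set X) = 0 := by
  have hc := StoneSpace.isClopen_basic A
  have h0 : extendedMeasure μ (StoneSpace.basic A) = 0 ↔ μ (A : Set X) = 0 := by
    rw [extendedMeasure_basic, ENNReal.coe_eq_zero]
  rw [← h0]
  constructor
  · intro hd
    refine hc.isClosed.isCompact.measure_zero_of_nhdsWithin fun x hx => ?_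
    obtain ⟨U, hU, hU0⟩ := Measure.notMem_support_iff_exists.mp (Set.disjoint_right.mp hd hx)
    exact ⟨U, mem_nhdsWithin_of_mem_nhds hU, hU0⟩
  · intro h
    refine Set.disjoint_right.mpr fun x hx => Measure.notMem_support_iff_exists.mpr ?_
    exact ⟨_, hc.isOpen.mem_nhds hx, h⟩

theorem supp_subset_basic_iff (μ : Charge X) (A : {s : Set X // MeasurableSet s}) :
    supp μ ⊆ StoneSpace.basic A ↔ μ (A : Set X)ᶜ = 0 := by
  have h := disjoint_supp_basic_iff μ Aᶜ
  rwa [StoneSpace.basic_compl, Set.disjoint_compl_right_iff_subset] at h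

end Support

/-! ### Separation of a sequence of charges. -/

section Sequence

variable {X : Type*} [MeasurableSpace X] {μs : ℕ → Charge X} {μ : Charge X}

/-- The charges `μs` live on measurable sets which are null for all the other ones. -/
def StronglySeparated (μs : ℕ → Charge X) : Prop :=
  ∀ i, ∃ D : Set X, MeasurableSet D ∧ μs i Dᶜ = 0 ∧ ∀ j, j ≠ i → μs j D = 0

theorem le_of_hasSum (hsum : ∀ A : Set X, MeasurableSet A → HasSum (fun i => μs i A) (μ A))
    (i : ℕ) (A : Set X) (hA : MeasurableSet A) : μs i A ≤ μ A :=
  le_hasSum (hsum A hA) i fun _ _ => zero_le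

/-- Intersecting finitely many pairwise separating sets suffices, with the error halved at each
insertion. -/
theorem exists_small_of_pairwise_singular
    (hsing : Pairwise fun i j => Singular (μs i) (μs j)) (i : ℕ) (s : Finset ℕ) (hi : i ∉ s)
    {ε : ℝ≥0} (hε : 0 < ε) :
    ∃ D : Set X, MeasurableSet D ∧ μs i Dᶜ < ε ∧ ∑ j ∈ s, μs j D < ε := by
  induction s using Finset.induction generalizing ε with
  | empty => exact ⟨univ, MeasurableSet.univ, by simpa using hε, by simpa using hε⟩
  | insert k s hk ih =>
    rw [Finset.mem_insert, not_or] at hi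
    obtain ⟨D, hD, h1, h2⟩ := ih hi.2 (half_pos hε)
    obtain ⟨E, hE, h3, h4⟩ := hsing (Ne.symm hi.1) (ε / 2) (half_pos hε)
    refine ⟨D ∩ E, hD.inter hE, ?_, ?_⟩
    · rw [compl_inter]
      calc μs i (Dᶜ ∪ Eᶜ) ≤ μs i Dᶜ + μs i Eᶜ :=
            charge_le_add _ (hD.compl.union hE.compl) hD.compl hE.compl subset_rfl
        _ < ε / 2 + ε / 2 := add_lt_add h1 h4
        _ = ε := add_halves ε
    · rw [Finset.sum_insert hk]
      calc μs k (D ∩ E) + ∑ j ∈ s, μs j (D ∩ E) ≤ μs k E + ∑ j ∈ s, μs j D :=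
            add_le_add (charge_mono _ (hD.inter hE) hE inter_subset_right)
              (Finset.sum_le_sum fun j _ => charge_mono _ (hD.inter hE) hD inter_subset_left)
        _ < ε / 2 + ε / 2 := add_lt_add h3 h2
        _ = ε := add_halves ε

/-- Each term of a sum of pairwise singular charges is singular to the sum of the others. -/
theorem singular_chargeSub (hsing : Pairwise fun i j => Singular (μs i) (μs j))
    (hsum : ∀ A : Set X, MeasurableSet A → HasSum (fun i => μs i A) (μ A)) (i : ℕ) :
    Singular (chargeSub μ (μs i) (le_of_hasSum hsum i)) (μs i) := by
  intro ε hε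
  have hlt : μ univ < μ univ + ε / 2 := lt_add_of_pos_right _ (half_pos hε)
  obtain ⟨s, hs⟩ := (((hsum univ MeasurableSet.univ).add_const (ε / 2)).eventually_const_lt
    hlt).exists
  obtain ⟨D, hD, h1, h2⟩ := exists_small_of_pairwise_singular hsing i (s.erase i)
    (Finset.notMem_erase i s) (half_pos hε)
  refine ⟨D, hD, ?_, h1.trans (half_lt_self hε)⟩
  rw [chargeSub_apply, tsub_lt_iff_left (le_of_hasSum hsum i D hD)]
  have h3 : ∑ j ∈ s, μs j D ≤ μs i D + ∑ j ∈ s.erase i, μs j D := by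
    rw [← Finset.sum_insert (f := fun j => μs j D) (Finset.notMem_erase i s)]
    exact Finset.sum_le_sum_of_subset (Finset.insert_erase_subset i s)
  -- The terms outside `s` have total mass below `ε / 2` on the whole space, hence also on `D`.
  have h4 : μ D + μ Dᶜ < ∑ j ∈ s, μs j D + ε / 2 + μ Dᶜ := by
    calc μ D + μ Dᶜ = μ univ := charge_add_compl μ hD
      _ < ∑ j ∈ s, μs j univ + ε / 2 := hs
      _ = ∑ j ∈ s, μs j D + ε / 2 + ∑ j ∈ s, μs j Dᶜ := by
          rw [add_right_comm, ← Finset.sum_add_distrib]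
          simp only [charge_add_compl _ hD]
      _ ≤ ∑ j ∈ s, μs j D + ε / 2 + μ Dᶜ := by
          gcongr
          exact sum_le_hasSum _ (fun _ _ => zero_le) (hsum _ hD.compl)
  calc μ D < ∑ j ∈ s, μs j D + ε / 2 := lt_of_add_lt_add_right h4
    _ ≤ μs i D + ∑ j ∈ s.erase i, μs j D + ε / 2 := by gcongr
    _ ≤ μs i D + ε / 2 + ε / 2 := by gcongr
    _ = μs i D + ε := by rw [add_assoc, add_halves]

theorem AdditiveProperty.stronglySeparated (hμ : AdditiveProperty μ)
    (hsing : Pairwise fun i j => Singular (μs i) (μs j))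
    (hsum : ∀ A : Set X, MeasurableSet A → HasSum (fun i => μs i A) (μ A)) :
    StronglySeparated μs := by
  classical
  intro i
  obtain ⟨D, hD, h1, h2⟩ := hμ.stronglySingular (fun A _ => tsub_le_self)
    (le_of_hasSum hsum i) (singular_chargeSub hsing hsum i)
  refine ⟨D, hD, h2, fun j hj => le_antisymm ?_ zero_le⟩
  -- On `D` the term `μs i` already exhausts `μ`, which leaves nothing for any other term.
  have h3 : μ D ≤ μs i D := tsub_eq_zero_iff_le.mp h1
  have h4 : ∑ k ∈ {i, j}, μs k D ≤ μ D := sum_le_hasSum _ (fun _ _ => zero_le) (hsum D hD)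
  rw [Finset.sum_pair hj.symm] at h4
  exact le_of_add_le_add_left ((h4.trans h3).trans (add_zero _).ge)

theorem StronglySeparated.pairwise_stronglySingular (h : StronglySeparated μs) :
    Pairwise fun i j => StronglySingular (μs i) (μs j) := fun i j hij => by
  obtain ⟨D, hD, h1, h2⟩ := h j
  exact ⟨D, hD, h2 i hij, h1⟩

theorem StronglySeparated.limsup_supp_inter_eq_empty (h : StronglySeparated μs) :
    (⋂ i, closure (⋃ j, ⋃ (_ : i ≤ j), supp (μs j))) ∩ (⋃ i, supp (μs i)) = ∅ := by
  refine eq_empty_of_forall_notMem fun x hx => ?_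
  obtain ⟨i, hi⟩ := mem_iUnion.mp hx.2
  obtain ⟨D, hD, h1, h2⟩ := h i
  -- The tail starts at `i + 1` so that it omits `i`; the clopen set of `D` contains `supp (μs i)`
  -- and misses this whole tail, hence also its closure.
  have hsub : closure (⋃ j, ⋃ (_ : i + 1 ≤ j), supp (μs j)) ⊆
      (StoneSpace.basic (⟨D, hD⟩ : {s : Set X // MeasurableSet s}))ᶜ := by
    refine closure_minimal (iUnion₂_subset fun j hj => ?_)
      (StoneSpace.isClopen_basic _).isOpen.isClosed_compl
    exact ((disjoint_supp_basic_iff (μs j) ⟨D, hD⟩).mpr (h2 j (by omega))).subset_compl_right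
  exact hsub (mem_iInter.mp hx.1 (i + 1)) ((supp_subset_basic_iff (μs i) ⟨D, hD⟩).mpr h1 hi)

/-- The closed tails decrease, so by compactness `supp (μs i)` already misses one of them, say from
`m` on. A clopen set between deals with the indices `j ≥ m`, and removing finitely many `μs i`-null
sets deals with `j < m`. -/
theorem stronglySeparated_of_limsup_supp
    (hstr : Pairwise fun i j => StronglySingular (μs i) (μs j))
    (hlim : (⋂ i, closure (⋃ j, ⋃ (_ : i ≤ j), supp (μs j))) ∩ (⋃ i, supp (μs i)) = ∅) :
    StronglySeparated μs := by
  intro i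
  have hcl : IsClosed (supp (μs i)) := Measure.isClosed_support
  obtain ⟨m, hm⟩ := hcl.isCompact.elim_directed_family_closed
    (fun n => closure (⋃ j, ⋃ (_ : n ≤ j), supp (μs j))) (fun _ => isClosed_closure)
    (by
      rw [inter_comm]
      exact subset_eq_empty (inter_subset_inter_right _
        (subset_iUnion (fun k => supp (μs k)) i)) hlim)
    (directed_of_isDirected_le fun a b hab => closure_mono
      (iUnion_mono fun j => iUnion_subset fun hj => subset_iUnion_of_subset (hab.trans hj)
        subset_rfl))
  obtain ⟨A, hA1, hA2⟩ := StoneSpace.exists_basic_between hcl.isCompact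
    (isClosed_closure (s := ⋃ j, ⋃ (_ : m ≤ j), supp (μs j))).isOpen_compl
    (Set.disjoint_left.mp (disjoint_iff_inter_eq_empty.mpr hm))
  -- The default `∅` at `j = i` lets the union below run over all `j < m`.
  have hE : ∀ j, ∃ E : Set X, MeasurableSet E ∧ μs i E = 0 ∧ (j ≠ i → μs j Eᶜ = 0) := fun j => by
    by_cases hj : j = i
    · exact ⟨∅, MeasurableSet.empty, addContent_empty, fun h => absurd hj h⟩
    · obtain ⟨E, h1, h2, h3⟩ := hstr (Ne.symm hj)
      exact ⟨E, h1, h2, fun _ => h3⟩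
  choose E hE hiE hjE using hE
  have hU : MeasurableSet (⋃ j ∈ Finset.range m, E j) :=
    Finset.measurableSet_biUnion _ fun j _ => hE j
  refine ⟨A \ ⋃ j ∈ Finset.range m, E j, A.2.diff hU, ?_, fun j hj => ?_⟩
  · refine le_antisymm ((charge_le_add (μs i) (A.2.diff hU).compl A.2.compl hU ?_).trans ?_) zero_le
    · intro x hx
      by_cases hxA : x ∈ (A : Set X)
      · exact Or.inr (by_contra fun hxU => hx ⟨hxA, hxU⟩)
      · exact Or.inl hxA
    · rw [(supp_subset_basic_iff _ A).mp hA1, zero_add]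
      exact (addContent_biUnion_le isSetRing_measurableSet fun j _ => hE j).trans (by simp [hiE])
  · by_cases hjm : j < m
    · refine charge_eq_zero_of_subset _ (A.2.diff hU) (hE j).compl ?_ (hjE j hj)
      exact fun x hx hxE => hx.2 (mem_biUnion (Finset.mem_coe.mpr (Finset.mem_range.mpr hjm)) hxE)
    · refine charge_eq_zero_of_subset _ (A.2.diff hU) A.2 sdiff_subset
        ((disjoint_supp_basic_iff _ A).mp (Set.disjoint_right.mpr fun x hxA hxS => hA2 hxA ?_))
      exact subset_closure (mem_iUnion₂.mpr ⟨j, not_lt.mp hjm, hxS⟩)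

/-- The sets which separate the charges can be taken disjoint. -/
theorem StronglySeparated.exists_disjoint (h : StronglySeparated μs) :
    ∃ D : ℕ → Set X, (∀ i, MeasurableSet (D i)) ∧ Pairwise (Function.onFun Disjoint D) ∧
      ∀ i, μs i (D i)ᶜ = 0 := by
  choose D hD h1 h2 using h
  refine ⟨disjointed D, fun i => MeasurableSet.disjointed hD i, disjoint_disjointed D,
    fun i => ?_⟩
  -- What `disjointed` removes from `D i` is a finite union of `μs i`-null sets, so `μs i` still
  -- lives on the rest.
  have hU : MeasurableSet (⋃ j ∈ Finset.range i, D j) :=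
    Finset.measurableSet_biUnion _ fun j _ => hD j
  refine le_antisymm ((charge_le_add (μs i) (MeasurableSet.disjointed hD i).compl (hD i).compl
    hU ?_).trans ?_) zero_le
  · intro x hx
    by_cases hxD : x ∈ D i
    · refine Or.inr (by_contra fun hxU => hx ?_)
      rw [disjointed_eq_inter_compl]
      refine ⟨hxD, mem_iInter₂.mpr fun j hj hxj => hxU ?_⟩
      exact mem_biUnion (Finset.mem_coe.mpr (Finset.mem_range.mpr hj)) hxj
    · exact Or.inl hxD
  · rw [h1, zero_add]
    refine (addContent_biUnion_le isSetRing_measurableSet fun j _ => hD j).trans ?_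
    exact (Finset.sum_eq_zero fun j hj => h2 j i (Finset.mem_range.mp hj).ne').le

/-- On the disjoint carrier `D i`, the countable union of the sets `B k ∩ D k` agrees with `B i`.
Thus `μs i`, which vanishes off `D i`, sees only `B i`, and no countable additivity is needed. -/
theorem StronglySeparated.additiveProperty (h : StronglySeparated μs)
    (hAP : ∀ i, AdditiveProperty (μs i))
    (hsum : ∀ A : Set X, MeasurableSet A → HasSum (fun i => μs i A) (μ A)) :
    AdditiveProperty μ := by
  intro ε hε A hA hm L hL
  obtain ⟨D, hD, hdis, hnull⟩ := h.exists_disjoint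
  obtain ⟨δ, hδ, c, hc, hcε⟩ := NNReal.exists_pos_sum_of_countable hε.ne' ℕ
  choose M hM using fun i => exists_tendsto_charge (μs i) hA hm
  choose B hB hBM hB0 using fun i => hAP i (δ i) (hδ i) A hA hm (M i) (hM i)
  have hU : MeasurableSet (⋃ i, B i ∩ D i) := MeasurableSet.iUnion fun i => (hB i).inter (hD i)
  refine ⟨⋃ i, B i ∩ D i, hU, ?_, fun n => ?_⟩
  · have hi : ∀ i, μs i (⋃ k, B k ∩ D k) ≤ M i + δ i := fun i => by
      refine le_trans ?_ (hBM i)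
      rw [← add_zero (μs i (B i)), ← hnull i]
      refine charge_le_add _ hU (hB i) (hD i).compl fun x hx => ?_
      obtain ⟨k, hxB, hxD⟩ := mem_iUnion.mp hx
      by_cases hki : k = i
      · exact Or.inl (hki ▸ hxB)
      · exact Or.inr (Set.disjoint_left.mp (hdis hki) hxD)
    -- Bounding finite partial sums avoids exchanging the infinite sum with the limit in `n`: `∑ i ∈
    -- s, M i ≤ L` follows termwise, and the errors `δ i` add up to less than `ε`.
    refine hasSum_le_of_sum_le (hsum _ hU) fun s => ?_
    calc ∑ i ∈ s, μs i (⋃ k, B k ∩ D k) ≤ ∑ i ∈ s, (M i + δ i) :=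
          Finset.sum_le_sum fun i _ => hi i
      _ = ∑ i ∈ s, M i + ∑ i ∈ s, δ i := Finset.sum_add_distrib
      _ ≤ L + ε := by
          refine add_le_add ?_ ((sum_le_hasSum _ (fun _ _ => zero_le) hc).trans hcε.le)
          exact le_of_tendsto_of_tendsto' (tendsto_finsetSum s fun i _ => hM i) hL fun n =>
            sum_le_hasSum _ (fun _ _ => zero_le) (hsum _ (hA n))
  · have h0 : ∀ i, μs i (A n \ ⋃ k, B k ∩ D k) = 0 := fun i => by
      refine le_antisymm ((charge_le_add (μs i) ((hA n).diff hU) ((hA n).diff (hB i))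
        (hD i).compl fun x hx => ?_).trans (by rw [hB0, hnull, add_zero])) zero_le
      by_cases hxD : x ∈ D i
      · exact Or.inl ⟨hx.1, fun hxB => hx.2 (mem_iUnion.mpr ⟨i, hxB, hxD⟩)⟩
      · exact Or.inr hxD
    have h1 := hsum _ ((hA n).diff hU)
    simp only [h0] at h1
    exact h1.unique hasSum_zero

end Sequence

end ChargeTheory

theorem theorem4p3 {X : Type*} [MeasurableSpace X]
    (μs : ℕ → ChargeTheory.Charge X) (μ : ChargeTheory.Charge X)
    (hsing : Pairwise fun i j => ChargeTheory.Singular (μs i) (μs j))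
    (hsum : ∀ A : Set X, MeasurableSet A → HasSum (fun i => μs i A) (μ A)) :
    ChargeTheory.AdditiveProperty μ ↔
      (∀ i, ChargeTheory.AdditiveProperty (μs i)) ∧
      (Pairwise fun i j => ChargeTheory.StronglySingular (μs i) (μs j)) ∧
      (⋂ i, closure (⋃ j, ⋃ (_ : i ≤ j), ChargeTheory.supp (μs j))) ∩
        (⋃ i, ChargeTheory.supp (μs i)) = ∅ := by
  constructor
  · intro hμ
    have hsep := hμ.stronglySeparated hsing hsum
    exact ⟨fun i => hμ.of_le (ChargeTheory.le_of_hasSum hsum i),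
      hsep.pairwise_stronglySingular, hsep.limsup_supp_inter_eq_empty⟩
  · rintro ⟨h1, h2, h3⟩
    exact (ChargeTheory.stronglySeparated_of_limsup_supp h2 h3).additiveProperty h1 hsum
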